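/- Let $G$ be a finite group. All representations are on finite-dimensional complex vector spaces; for a representation $\rho\colon G\to GL(V)$ write $Z(\rho(G))$ for the center of the group $\rho(G)$. (a) Let $\rho\colon G\to GL(V)$ be an irreducible representation with character $\chi$, let $g\in G$, and suppose that the number of conjugates of $g$ in $G$ is relatively prime to $\dim V$. Then $\rho(g)\in Z(\rho(G))$ or $\chi(g)=0$. (b) Let $C$ be the conjugacy class of an element $g\in G$ and suppose that $|C|=p^r$, where $p$ is a prime and $r\geq 1$. Then there is a nontrivial irreducible representation $\rho$ of $G$ (that is, an irreducible representation other than the trivial one) such that $\rho(C)\subseteq Z(\rho(G))$. Moreover, $G$ is not a simple group. -/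

import Mathlib

/-! (a) Let n = dim V. The class sum is integral over ℤ and acts by a scalar (Schur), so |C|χ(g)/n
is an algebraic integer; since |C| and n are coprime, Bézout makes χ(g)/n one too. It is an average
of n roots of unity, so `Multiset.sum_eq_zero_or_eq_of_isIntegral_average` makes it zero or all
eigenvalues of ρ(g) equal. As ρ(g) has finite order, equal eigenvalues make it scalar.

(b) For g ≠ 1 the regular character gives 1 + ∑ dim(ρ) χ_ρ(g) = 0 over nontrivial irreducible ρ. If
χ_ρ(g) vanished whenever p ∤ dim ρ, then -1/p would be an algebraic integer. So some such ρ has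
χ_ρ(g) ≠ 0, and (a) applies to it. -/

/-! ### Averages of roots of unity. -/

theorem Multiset.norm_sum_le_card {s : Multiset ℂ} (h : ∀ z ∈ s, ‖z‖ ≤ 1) :
    ‖s.sum‖ ≤ s.card := by
  refine (norm_multiset_sum_le s).trans ?_
  have := Multiset.sum_le_card_nsmul (s.map fun z => ‖z‖) 1 (by simpa using h)
  simpa using this

/-- Equality case of the triangle inequality: by strict convexity, distinct z and w have ‖z + w‖ <
2, and the other terms cannot make up the loss. -/
theorem Multiset.eq_of_norm_sum_eq_card {s : Multiset ℂ} (h : ∀ z ∈ s, ‖z‖ = 1)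
    (hs : ‖s.sum‖ = s.card) {z w : ℂ} (hz : z ∈ s) (hw : w ∈ s) : z = w := by
  by_contra hne
  obtain ⟨t, rfl⟩ := Multiset.exists_cons_of_mem hz
  have hw' : w ∈ t := (Multiset.mem_cons.1 hw).resolve_left (Ne.symm hne)
  obtain ⟨u, rfl⟩ := Multiset.exists_cons_of_mem hw'
  have hu : ‖u.sum‖ ≤ u.card :=
    Multiset.norm_sum_le_card fun x hx => (h x (by simp [hx])).le
  have hz1 := h z hz
  have hw1 := h w hw
  refine hne (eq_of_norm_eq_of_norm_add_eq (hz1.trans hw1.symm) (le_antisymm (norm_add_le _ _) ?_))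
  simp only [Multiset.sum_cons, Multiset.card_cons, Nat.cast_add, Nat.cast_one, ← add_assoc] at hs
  have := norm_add_le (z + w) u.sum
  linarith

/-- If the average of finitely many roots of unity is an algebraic integer, then it vanishes
or the roots of unity all agree. -/
theorem Multiset.sum_eq_zero_or_eq_of_isIntegral_average {s : Multiset ℂ} {m : ℕ} (hm : 0 < m)
    (hs : ∀ z ∈ s, z ^ m = 1) (hint : IsIntegral ℤ (s.sum / s.card)) :
    s.sum = 0 ∨ ∀ z ∈ s, ∀ w ∈ s, z = w := by
  by_cases h0 : s.sum = 0
  · exact Or.inl h0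
  right
  have hfin : {z : ℂ | z ^ m = 1}.Finite := by
    refine (Polynomial.nthRoots m (1 : ℂ)).toFinset.finite_toSet.subset fun z hz => ?_
    simpa [Polynomial.mem_nthRoots hm] using hz
  let K := IntermediateField.adjoin ℚ {z : ℂ | z ^ m = 1}
  have : Finite {z : ℂ | z ^ m = 1} := hfin
  have : FiniteDimensional ℚ K := by
    refine IntermediateField.finiteDimensional_adjoin fun z hz => ?_
    exact IsIntegral.of_pow hm (by rw [show z ^ m = 1 from hz]; exact isIntegral_one)
  have : NumberField K := { to_charZero := inferInstance, to_finiteDimensional := inferInstance }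
  have hK : ∀ z ∈ s, z ∈ K := fun z hz => IntermediateField.subset_adjoin _ _ (hs z hz)
  lift s to Multiset K using hK
  have key : ∀ φ : K →+* ℂ, ∀ z ∈ s, ‖φ z‖ = 1 := by
    intro φ z hz
    have : z ^ m = 1 := Subtype.ext (by simpa using hs z (Multiset.mem_map_of_mem _ hz))
    exact Complex.norm_eq_one_of_pow_eq_one (by rw [← map_pow, this, map_one]) hm.ne'
  have hsum : ∀ φ : K →+* ℂ, φ s.sum = (s.map φ).sum := fun φ => map_multiset_sum φ s
  have hsum' : ((s.map (fun z : K => (z : ℂ))).sum) = (s.sum : K) := (hsum K.val.toRingHom).symm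
  simp only [hsum', Multiset.card_map] at hint h0 ⊢
  have hne : s.sum ≠ 0 := fun h => h0 (by rw [h]; rfl)
  have hcard : s.card ≠ 0 := by
    rintro h
    rw [Multiset.card_eq_zero] at h
    simp [h] at hne
  have hint' : IsIntegral ℤ (s.sum / s.card : K) := by
    rw [← isIntegral_algebraMap_iff (B := ℂ) (algebraMap K ℂ).injective]
    simpa using hint
  -- Kronecker: every embedding of `K` sends the average to an average of roots of unity, of norm at
  -- most 1, so a nonzero integral average is a root of unity.
  obtain ⟨k, hk, hpow⟩ := NumberField.Embeddings.pow_eq_one_of_norm_le_one K ℂ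
    (div_ne_zero hne (by exact_mod_cast hcard)) hint' (fun φ => by
      rw [map_div₀, map_natCast, hsum, norm_div, Complex.norm_natCast]
      refine div_le_one_of_le₀ ?_ (by positivity)
      simpa using Multiset.norm_sum_le_card (s := s.map φ) (by
        intro z hz
        obtain ⟨x, hx, rfl⟩ := Multiset.mem_map.1 hz
        exact (key φ x hx).le))
  have hnorm : ‖(s.sum : ℂ) / s.card‖ = 1 :=
    Complex.norm_eq_one_of_pow_eq_one (n := k)
      (by simpa using congrArg (fun x : K => (x : ℂ)) hpow) hk.ne'
  intro z hz w hw
  refine Multiset.eq_of_norm_sum_eq_card (s := s.map (fun z : K => (z : ℂ)))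
    (fun z hz => Complex.norm_eq_one_of_pow_eq_one (hs z hz) hm.ne') ?_ hz hw
  rw [norm_div, Complex.norm_natCast, div_eq_one_iff_eq (by exact_mod_cast hcard)] at hnorm
  rw [hsum', hnorm, Multiset.card_map]

/-! ### Endomorphisms of finite order. -/

open Polynomial in
theorem Module.End.eq_algebraMap_of_pow_eq_one {V : Type*} [AddCommGroup V] [Module ℂ V]
    [FiniteDimensional ℂ V] {f : Module.End ℂ V} {m : ℕ} (hm : 0 < m) (hf : f ^ m = 1)
    (h : ∀ z ∈ f.charpoly.roots, ∀ w ∈ f.charpoly.roots, z = w) :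
    ∃ c : ℂ, f = algebraMap ℂ (Module.End ℂ V) c := by
  obtain ⟨c, hc⟩ : ∃ c, ∀ z ∈ f.charpoly.roots, z = c := by
    by_cases h0 : ∃ c, c ∈ f.charpoly.roots
    · exact ⟨h0.choose, fun z hz => h z hz _ h0.choose_spec⟩
    -- No eigenvalue means V = 0, where any scalar serves.
    · exact ⟨0, fun z hz => (h0 ⟨z, hz⟩).elim⟩
  have hroots := Multiset.eq_replicate_card.2 hc
  have hchar : f.charpoly = (X - C c) ^ (f.charpoly.roots.card) := by
    conv_lhs => rw [(IsAlgClosed.splits f.charpoly).eq_prod_roots_of_monic f.charpoly_monic, hroots]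
    simp
  -- A squarefree divisor of a power of X - c divides X - c.
  have hsq : Squarefree (minpoly ℂ f) := by
    have hsep : (X ^ m - 1 : ℂ[X]).Separable := by
      simpa using separable_X_pow_sub_C (1 : ℂ) (by exact_mod_cast hm.ne') one_ne_zero
    exact hsep.squarefree.squarefree_of_dvd (minpoly.dvd _ _ (by simp [hf]))
  have hdvd : minpoly ℂ f ∣ X - C c := by
    refine hsq.isRadical f.charpoly.roots.card _ ?_
    rw [← hchar]
    exact f.minpoly_dvd_charpoly
  refine ⟨c, sub_eq_zero.1 ?_⟩
  simpa using (aeval_eq_zero_of_dvd_aeval_eq_zero hdvd (minpoly.aeval ℂ f))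

open Polynomial in
theorem Module.End.pow_eq_one_of_mem_roots_charpoly {V : Type*} [AddCommGroup V] [Module ℂ V]
    [FiniteDimensional ℂ V] {f : Module.End ℂ V} {m : ℕ} (hf : f ^ m = 1) {z : ℂ}
    (hz : z ∈ f.charpoly.roots) : z ^ m = 1 := by
  have hev : f.HasEigenvalue z :=
    (Module.End.hasEigenvalue_iff_isRoot_charpoly f z).2 (isRoot_of_mem_roots hz)
  obtain ⟨v, hv⟩ := hev.exists_hasEigenvector
  have := hv.pow_apply m
  rw [hf, Module.End.one_apply] at this
  have h2 : (z ^ m - 1) • v = 0 := by rw [sub_smul, ← this, one_smul, sub_self]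
  exact sub_eq_zero.1 ((smul_eq_zero.1 h2).resolve_right hv.2)

theorem Module.End.isIntegral_trace_of_pow_eq_one {V : Type*} [AddCommGroup V] [Module ℂ V]
    [FiniteDimensional ℂ V] {f : Module.End ℂ V} {m : ℕ} (hm : 0 < m) (hf : f ^ m = 1) :
    IsIntegral ℤ (LinearMap.trace ℂ V f) := by
  rw [Module.End.trace_eq_sum_roots_charpoly_of_splits (IsAlgClosed.splits _)]
  refine IsIntegral.multiset_sum fun z hz => ?_
  exact IsIntegral.of_pow hm (by rw [pow_eq_one_of_mem_roots_charpoly hf hz]; exact isIntegral_one)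

/-- An endomorphism of finite order whose normalized trace is an algebraic integer
is a scalar or has trace zero. -/
theorem Module.End.eq_algebraMap_or_trace_eq_zero {V : Type*} [AddCommGroup V] [Module ℂ V]
    [FiniteDimensional ℂ V] {f : Module.End ℂ V} {m : ℕ} (hm : 0 < m) (hf : f ^ m = 1)
    (hint : IsIntegral ℤ (LinearMap.trace ℂ V f / Module.finrank ℂ V)) :
    (∃ c : ℂ, f = algebraMap ℂ (Module.End ℂ V) c) ∨ LinearMap.trace ℂ V f = 0 := by
  have hcard : f.charpoly.roots.card = Module.finrank ℂ V := by
    rw [← (IsAlgClosed.splits f.charpoly).natDegree_eq_card_roots, f.charpoly_natDegree]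
  have htr := Module.End.trace_eq_sum_roots_charpoly_of_splits (IsAlgClosed.splits f.charpoly)
  rw [htr, ← hcard] at hint
  rw [htr]
  exact (Multiset.sum_eq_zero_or_eq_of_isIntegral_average hm
    (fun z hz => pow_eq_one_of_mem_roots_charpoly hf hz) hint).symm.imp_left
      (eq_algebraMap_of_pow_eq_one hm hf)

/-! ### Integrality of characters and part (a). -/

namespace Representation

variable {G V : Type*} [Group G] [AddCommGroup V] [Module ℂ V]

/-- The sum of a conjugacy class acts on an irreducible representation by an
algebraic integer. -/
theorem isIntegral_ncard_mul_character_div_finrank [Finite G] [FiniteDimensional ℂ V]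
    (ρ : Representation ℂ G V) [hρ : ρ.IsIrreducible] [Nontrivial V] (g : G) :
    IsIntegral ℤ ((conjugatesOf g).ncard * ρ.character g / Module.finrank ℂ V : ℂ) := by
  classical
  have := Fintype.ofFinite G
  let C : Finset G := (conjugatesOf g).toFinset
  have hC : ∀ x, x ∈ C ↔ IsConj g x := fun x => Set.mem_toFinset
  let T : V →ₗ[ℂ] V := ∑ x ∈ C, ρ x
  have hT : ∀ h : G, T * ρ h = ρ h * T := by
    intro h
    simp only [T, Finset.sum_mul, Finset.mul_sum, ← map_mul]
    refine Finset.sum_bij' (fun x _ => h⁻¹ * x * h) (fun x _ => h * x * h⁻¹) ?_ ?_ ?_ ?_ ?_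
    · intro x hx
      rw [hC] at hx ⊢
      exact hx.trans (isConj_iff.2 ⟨h⁻¹, by simp⟩)
    · intro x hx
      rw [hC] at hx ⊢
      exact hx.trans (isConj_iff.2 ⟨h, rfl⟩)
    all_goals intros; simp [mul_assoc]
  let F : IntertwiningMap ρ ρ := ⟨T, fun h => hT h⟩
  obtain ⟨c, hc⟩ := (IsIrreducible.algebraMap_intertwiningMap_bijective_of_isAlgClosed (ρ := ρ)).2 F
  have hTc : T = algebraMap ℂ (Module.End ℂ V) c := by
    have := congrArg IntertwiningMap.toLinearMap hc
    rw [← show F.toLinearMap = T from rfl, ← this]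
    rfl
  have hint : IsIntegral ℤ T := by
    -- The class sum already lives in ℤ[G], which is a finite ℤ-module.
    let φ : MonoidAlgebra ℤ G →ₐ[ℤ] Module.End ℂ V := MonoidAlgebra.lift ℤ _ G ρ
    have h1 : φ (∑ x ∈ C, MonoidAlgebra.single x 1) = T := by
      simp [φ, T, map_sum, MonoidAlgebra.lift_single]
    have : Module.Finite ℤ (MonoidAlgebra ℤ G) := Module.Finite.of_basis (MonoidAlgebra.basis G ℤ)
    rw [← h1]
    exact (IsIntegral.of_finite ℤ _).map φ
  have hcint : IsIntegral ℤ c := by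
    rw [hTc] at hint
    exact (isIntegral_algebraMap_iff (algebraMap ℂ (Module.End ℂ V)).injective).1 hint
  have htr : LinearMap.trace ℂ V T = (conjugatesOf g).ncard * ρ.character g := by
    simp only [T, map_sum]
    rw [Finset.sum_congr rfl (g := fun _ => ρ.character g), Finset.sum_const, nsmul_eq_mul,
      Set.ncard_eq_toFinset_card']
    intro x hx
    obtain ⟨h, rfl⟩ := isConj_iff.1 ((hC x).1 hx)
    exact ρ.char_conj g h
  have hn : (Module.finrank ℂ V : ℂ) ≠ 0 := by exact_mod_cast Module.finrank_pos.ne'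
  rw [← htr, hTc, Algebra.algebraMap_eq_smul_one, map_smul, LinearMap.trace_one, smul_eq_mul,
    mul_div_cancel_right₀ _ hn]
  exact hcint

theorem isIntegral_character [Finite G] [FiniteDimensional ℂ V]
    (ρ : Representation ℂ G V) (g : G) : IsIntegral ℤ (ρ.character g) :=
  Module.End.isIntegral_trace_of_pow_eq_one (m := Nat.card G) Nat.card_pos
    (by rw [← map_pow, pow_card_eq_one', map_one])

theorem IsIrreducible.nontrivial (ρ : Representation ℂ G V) [hρ : ρ.IsIrreducible] :
    Nontrivial V := by
  by_contra h
  rw [not_nontrivial_iff_subsingleton] at h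
  have : Subsingleton (Subrepresentation ρ) := Subrepresentation.toSubmodule_injective.subsingleton
  exact not_subsingleton _ this

/-- If the size of the conjugacy class of `g` is coprime to the degree of an irreducible
representation, then `g` acts by a scalar or its character value vanishes. -/
theorem IsIrreducible.eq_algebraMap_or_character_eq_zero [Finite G] [FiniteDimensional ℂ V]
    (ρ : Representation ℂ G V) [ρ.IsIrreducible] (g : G)
    (h : Nat.Coprime (conjugatesOf g).ncard (Module.finrank ℂ V)) :
    (∃ c : ℂ, ρ g = algebraMap ℂ (Module.End ℂ V) c) ∨ ρ.character g = 0 := by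
  have := IsIrreducible.nontrivial ρ
  refine Module.End.eq_algebraMap_or_trace_eq_zero Nat.card_pos
    (f := ρ g) (m := Nat.card G) (by rw [← map_pow]; simp) ?_
  have hbez := Nat.gcd_eq_gcd_ab (conjugatesOf g).ncard (Module.finrank ℂ V)
  rw [h.gcd_eq_one] at hbez
  set a := Nat.gcdA (conjugatesOf g).ncard (Module.finrank ℂ V)
  set b := Nat.gcdB (conjugatesOf g).ncard (Module.finrank ℂ V)
  have hbez' : (1 : ℂ) = (conjugatesOf g).ncard * a + Module.finrank ℂ V * b := by
    exact_mod_cast congrArg (Int.cast : ℤ → ℂ) hbez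
  have hn : (Module.finrank ℂ V : ℂ) ≠ 0 := by exact_mod_cast Module.finrank_pos.ne'
  have : ρ.character g / Module.finrank ℂ V =
      a * ((conjugatesOf g).ncard * ρ.character g / Module.finrank ℂ V) + b * ρ.character g := by
    field_simp
    linear_combination (ρ.character g) * hbez'
  change IsIntegral ℤ (ρ.character g / Module.finrank ℂ V)
  rw [this]
  exact ((isIntegral_algebraMap (R := ℤ) (x := a)).mul
    (isIntegral_ncard_mul_character_div_finrank ρ g)).add
    ((isIntegral_algebraMap (R := ℤ) (x := b)).mul (isIntegral_character ρ g))

theorem rangeRestrict_mem_center_of_eq_algebraMap (ρ : Representation ℂ G V) {g : G} {c : ℂ}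
    (h : ρ g = algebraMap ℂ (Module.End ℂ V) c) :
    ρ.asGroupHom.rangeRestrict g ∈ Subgroup.center ρ.asGroupHom.range := by
  rw [Subgroup.mem_center_iff]
  rintro ⟨_, x, rfl⟩
  ext1
  ext1
  change ρ.asGroupHom x * (ρ.asGroupHom g : Module.End ℂ V) = ρ.asGroupHom g * ρ.asGroupHom x
  rw [asGroupHom_apply, asGroupHom_apply, h]
  exact (Algebra.commutes c _).symm

end Representation

/-! ### The regular representation and its matrix blocks. -/

theorem LinearMap.trace_mulLeft_pi_matrix {ι : Type*} [Fintype ι] (d : ι → ℕ)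
    (x : ∀ i, Matrix (Fin (d i)) (Fin (d i)) ℂ) :
    LinearMap.trace ℂ _ (LinearMap.mulLeft ℂ x) = ∑ i, (d i : ℂ) * (x i).trace := by
  classical
  rw [LinearMap.trace_eq_matrix_trace ℂ (Pi.basis fun i => Matrix.stdBasis ℂ (Fin (d i)) (Fin (d i)))]
  simp only [Matrix.trace, Matrix.diag, LinearMap.toMatrix_apply]
  rw [Fintype.sum_sigma]
  refine Finset.sum_congr rfl fun i _ => ?_
  rw [Fintype.sum_prod_type, Finset.mul_sum]
  refine Finset.sum_congr rfl fun a _ => ?_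
  -- The diagonal entry does not depend on the column b, whence the factor `d i`.
  have : ∀ b, ((Pi.basis fun i => Matrix.stdBasis ℂ (Fin (d i)) (Fin (d i))).repr
      (LinearMap.mulLeft ℂ x ((Pi.basis fun i => Matrix.stdBasis ℂ (Fin (d i)) (Fin (d i)))
        ⟨i, (a, b)⟩))) ⟨i, (a, b)⟩ = x i a a := by
    intro b
    rw [Pi.basis_repr, Pi.basis_apply, LinearMap.mulLeft_apply, Pi.mul_apply, Pi.single_eq_same,
      Matrix.stdBasis_eq_single]
    simp [Matrix.stdBasis]
  rw [Finset.sum_congr rfl fun b _ => this b]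
  simp

namespace MonoidAlgebra

variable {G : Type*} [Group G]

theorem trace_mulLeft_of [Finite G] {g : G} (hg : g ≠ 1) :
    LinearMap.trace ℂ _ (LinearMap.mulLeft ℂ (of ℂ G g)) = 0 := by
  classical
  have := Fintype.ofFinite G
  rw [LinearMap.trace_eq_matrix_trace ℂ (basis G ℂ), Matrix.trace]
  refine Finset.sum_eq_zero fun h _ => ?_
  rw [Matrix.diag_apply, LinearMap.toMatrix_apply, basis_apply, LinearMap.mulLeft_apply, of_apply,
    single_mul_single]
  simp [basis, hg]

variable {d : ℕ} (φ : MonoidAlgebra ℂ G →ₐ[ℂ] Matrix (Fin d) (Fin d) ℂ)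

/-- The matrix representation of a group underlying a matrix representation of its
group algebra. -/
noncomputable def matrixRepresentation : Representation ℂ G (Fin d → ℂ) :=
  ((Matrix.toLinAlgEquiv' : _ ≃ₐ[ℂ] ((Fin d → ℂ) →ₗ[ℂ] (Fin d → ℂ))).toAlgHom.comp φ :
    MonoidAlgebra ℂ G →* _).comp (of ℂ G)

theorem matrixRepresentation_apply (g : G) (v : Fin d → ℂ) :
    matrixRepresentation φ g v = (φ (of ℂ G g)).mulVec v := rfl

theorem character_matrixRepresentation (g : G) :
    (matrixRepresentation φ).character g = (φ (of ℂ G g)).trace :=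
  Matrix.trace_toLin'_eq _

theorem mulVec_mem_of_forall_mem {W : Submodule ℂ (Fin d → ℂ)}
    (hW : ∀ g, ∀ v ∈ W, matrixRepresentation φ g v ∈ W) (a : MonoidAlgebra ℂ G)
    {v : Fin d → ℂ} (hv : v ∈ W) : (φ a).mulVec v ∈ W := by
  induction a using MonoidAlgebra.induction_on with
  | of g => exact hW g v hv
  | add a b ha hb => rw [map_add, Matrix.add_mulVec]; exact W.add_mem ha hb
  | smul r a ha => rw [map_smul, Matrix.smul_mulVec]; exact W.smul_mem r ha

theorem isIrreducible_matrixRepresentation [NeZero d] (hφ : Function.Surjective φ) :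
    (matrixRepresentation φ).IsIrreducible := by
  have : Nontrivial (Subrepresentation (matrixRepresentation φ)) := by
    refine ⟨⊥, ⊤, fun h => ?_⟩
    have := congrArg Subrepresentation.toSubmodule h
    exact bot_ne_top (α := Submodule ℂ (Fin d → ℂ)) this
  refine ⟨fun S => ?_⟩
  by_cases hS : S.toSubmodule = ⊥
  · exact Or.inl (Subrepresentation.toSubmodule_injective hS)
  right
  apply Subrepresentation.toSubmodule_injective
  obtain ⟨v, hv, hv0⟩ := S.toSubmodule.ne_bot_iff.1 hS
  obtain ⟨j, hj⟩ := Function.ne_iff.1 hv0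
  refine (Submodule.eq_top_iff').2 fun w => ?_
  -- A rank-one matrix carrying v to w.
  obtain ⟨a, ha⟩ := hφ (Matrix.vecMulVec w (Pi.single j (v j)⁻¹))
  have := mulVec_mem_of_forall_mem φ (fun g v hv => S.apply_mem_toSubmodule g hv) a hv
  have hj' : v j ≠ 0 := hj
  rw [ha, Matrix.vecMulVec_mulVec] at this
  simpa [hj'] using this

/-- On a trivial matrix representation the group algebra acts through the augmentation. -/
theorem apply_eq_lift_one_smul_of_isTrivial (h : (matrixRepresentation φ).IsTrivial)
    (a : MonoidAlgebra ℂ G) : φ a = (lift ℂ ℂ G 1 a) • (1 : Matrix (Fin d) (Fin d) ℂ) := by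
  induction a using MonoidAlgebra.induction_on with
  | of g =>
    have h1 : Matrix.toLinAlgEquiv' (φ (of ℂ G g)) = (LinearMap.id : (Fin d → ℂ) →ₗ[ℂ] _) := h.out g
    have h2 : φ (of ℂ G g) = 1 :=
      (Matrix.toLinAlgEquiv' : _ ≃ₐ[ℂ] ((Fin d → ℂ) →ₗ[ℂ] (Fin d → ℂ))).injective
        (h1.trans (map_one Matrix.toLinAlgEquiv').symm)
    rw [h2]
    simp
  | add a b ha hb => rw [map_add, map_add, ha, hb, add_smul]
  | smul r a ha => rw [map_smul, map_smul, ha, smul_eq_mul, mul_smul]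

theorem eq_one_of_isTrivial [NeZero d] (hφ : Function.Surjective φ)
    (h : (matrixRepresentation φ).IsTrivial) : d = 1 := by
  have hle : Module.finrank ℂ (Matrix (Fin d) (Fin d) ℂ) ≤ 1 := by
    refine finrank_le_one 1 fun A => ?_
    obtain ⟨a, rfl⟩ := hφ A
    exact ⟨_, (apply_eq_lift_one_smul_of_isTrivial φ h a).symm⟩
  have hd : 0 < d := NeZero.pos d
  simp only [Module.finrank_matrix, Fintype.card_fin, Module.finrank_self, mul_one] at hle
  nlinarith

end MonoidAlgebra

theorem Representation.IsIrreducible.isTrivial_of_exists_invariant {k G V : Type*} [Group G]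
    [Field k] [AddCommGroup V] [Module k V] (ρ : Representation k G V) [ρ.IsIrreducible] {v : V}
    (hv : v ≠ 0) (h : ∀ g, ρ g v = v) : ρ.IsTrivial := by
  let S : Subrepresentation ρ := ⟨ρ.invariants, fun g w hw => by rwa [hw g]⟩
  rcases eq_bot_or_eq_top S with hS | hS
  · have : v ∈ (⊥ : Subrepresentation ρ).toSubmodule := by
      rw [← hS]
      exact h
    exact (hv this).elim
  · refine ⟨fun g => LinearMap.ext fun w => ?_⟩
    have : w ∈ S.toSubmodule := by
      rw [hS]
      exact Submodule.mem_top
    exact this g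

/-- A prime is not a divisor of `-1` in the algebraic integers. -/
theorem Nat.Prime.one_add_mul_ne_zero {p : ℕ} (hp : p.Prime) {z : ℂ} (hz : IsIntegral ℤ z) :
    1 + p * z ≠ 0 := by
  intro h
  have hp0 : (p : ℂ) ≠ 0 := by exact_mod_cast hp.ne_zero
  have hz' : z = algebraMap ℚ ℂ (-1 / p) := by
    simp only [map_div₀, map_neg, map_one, map_natCast]
    field_simp
    linear_combination h
  rw [hz', isIntegral_algebraMap_iff (algebraMap ℚ ℂ).injective] at hz
  obtain ⟨m, hm⟩ := IsIntegrallyClosed.isIntegral_iff.1 hz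
  have hp0' : (p : ℚ) ≠ 0 := by exact_mod_cast hp.ne_zero
  have h1 : (m : ℤ) * p = -1 := by
    have : (m : ℚ) * p = -1 := by
      rw [show (m : ℚ) = -1 / p from hm]
      field_simp
    exact_mod_cast this
  have h2 : (p : ℤ) ∣ 1 := ⟨-m, by linarith⟩
  exact hp.one_lt.ne' (by exact_mod_cast Int.eq_one_of_dvd_one (by positivity) h2)

/-- A nonidentity element has, for every prime `p`, a nonzero character value on some nontrivial
irreducible representation of degree prime to `p`. -/
theorem Representation.exists_isIrreducible_character_ne_zero {G : Type*} [Group G] [Finite G]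
    {g : G} (hg : g ≠ 1) {p : ℕ} (hp : p.Prime) :
    ∃ (d : ℕ) (ρ : Representation ℂ G (Fin d → ℂ)), ρ.IsIrreducible ∧ ¬ ρ.IsTrivial ∧
      ¬ p ∣ d ∧ ρ.character g ≠ 0 := by
  classical
  have := Fintype.ofFinite G
  have : Module.Finite ℂ (MonoidAlgebra ℂ G) := Module.Finite.of_basis (MonoidAlgebra.basis G ℂ)
  obtain ⟨n, d, hd, ⟨e⟩⟩ :=
    IsSemisimpleRing.exists_algEquiv_pi_matrix_of_isAlgClosed ℂ (MonoidAlgebra ℂ G)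
  let φ (i : Fin n) : MonoidAlgebra ℂ G →ₐ[ℂ] Matrix (Fin (d i)) (Fin (d i)) ℂ :=
    (Pi.evalAlgHom ℂ (fun i => Matrix (Fin (d i)) (Fin (d i)) ℂ) i).comp e.toAlgHom
  have hφ : ∀ i, Function.Surjective (φ i) := fun i =>
    (Function.surjective_eval i).comp e.surjective
  have hirr := fun i => MonoidAlgebra.isIrreducible_matrixRepresentation (φ i) (hφ i)
  have hsum : ∑ i, (d i : ℂ) * (MonoidAlgebra.matrixRepresentation (φ i)).character g = 0 := by
    have h := MonoidAlgebra.trace_mulLeft_of hg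
    rw [← LinearMap.trace_conj' _ e.toLinearEquiv] at h
    have hconj : e.toLinearEquiv.conj (LinearMap.mulLeft ℂ (MonoidAlgebra.of ℂ G g)) =
        LinearMap.mulLeft ℂ (e (MonoidAlgebra.of ℂ G g)) := by
      refine LinearMap.ext fun x => ?_
      simp [LinearEquiv.conj_apply]
    rw [hconj, LinearMap.trace_mulLeft_pi_matrix] at h
    simp only [MonoidAlgebra.character_matrixRepresentation]
    exact h
  obtain ⟨i₀, hi₀⟩ : ∃ i, (MonoidAlgebra.matrixRepresentation (φ i)).IsTrivial := by
    -- The sum of all group elements is nonzero and fixed by G, so a nonzero column of its image in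
    -- some block is an invariant vector.
    let u : MonoidAlgebra ℂ G := ∑ h : G, MonoidAlgebra.of ℂ G h
    have hu : u ≠ 0 := by
      intro h
      have := congrArg (MonoidAlgebra.lift ℂ ℂ G 1) h
      simp [u, MonoidAlgebra.lift_single] at this
    have hgu : ∀ h, MonoidAlgebra.of ℂ G h * u = u := by
      intro h
      simp only [u, Finset.mul_sum, ← map_mul]
      exact Equiv.sum_comp (Equiv.mulLeft h) (fun x => MonoidAlgebra.of ℂ G x)
    obtain ⟨i, hi⟩ := Function.ne_iff.1 ((map_ne_zero_iff e e.injective).2 hu)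
    obtain ⟨b, hb⟩ : ∃ b, (φ i u).col b ≠ 0 := by
      by_contra! hcon
      exact hi (Matrix.ext fun a b => congrFun (hcon b) a)
    have := hirr i
    refine ⟨i, Representation.IsIrreducible.isTrivial_of_exists_invariant _ hb fun h => ?_⟩
    rw [MonoidAlgebra.matrixRepresentation_apply]
    conv_rhs => rw [← hgu h, map_mul]
    rfl
  have huniq : ∀ i, (MonoidAlgebra.matrixRepresentation (φ i)).IsTrivial → i = i₀ := by
    intro i hi
    by_contra hne
    -- The central idempotent of block i acts as 1 there and as 0 on block i₀, but two trivial
    -- blocks would both act through the augmentation.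
    obtain ⟨a, ha⟩ := e.surjective (Pi.single i 1)
    have h1 := MonoidAlgebra.apply_eq_lift_one_smul_of_isTrivial (φ i) hi a
    have h2 := MonoidAlgebra.apply_eq_lift_one_smul_of_isTrivial (φ i₀) hi₀ a
    have h1' : φ i a = 1 := (congrFun ha i).trans (Pi.single_eq_same _ _)
    have h2' : φ i₀ a = 0 := (congrFun ha i₀).trans (Pi.single_eq_of_ne (Ne.symm hne) _)
    rw [h2', eq_comm, smul_eq_zero_iff_left one_ne_zero] at h2
    rw [h1', h2, zero_smul] at h1
    exact one_ne_zero h1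
  by_contra! hcon
  have hdiv : ∀ i ∈ Finset.univ.erase i₀, ∃ z : ℂ, IsIntegral ℤ z ∧
      (d i : ℂ) * (MonoidAlgebra.matrixRepresentation (φ i)).character g = p * z := by
    intro i hi
    by_cases hpd : p ∣ d i
    · obtain ⟨c, hc⟩ := hpd
      exact ⟨c * (MonoidAlgebra.matrixRepresentation (φ i)).character g,
        (isIntegral_algebraMap (R := ℤ) (x := (c : ℤ))).mul (isIntegral_character _ g),
        by
          have hc' : (d i : ℂ) = p * c := by exact_mod_cast hc
          rw [hc', mul_assoc]⟩
    · refine ⟨0, isIntegral_zero, ?_⟩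
      rw [hcon (d i) _ (hirr i) (fun h => Finset.ne_of_mem_erase hi (huniq i h)) hpd]
      simp
  choose! z hz hzeq using hdiv
  rw [← Finset.add_sum_erase _ _ (Finset.mem_univ i₀), Finset.sum_congr rfl hzeq,
    ← Finset.mul_sum] at hsum
  have htriv : (d i₀ : ℂ) * (MonoidAlgebra.matrixRepresentation (φ i₀)).character g = 1 := by
    have hd1 := MonoidAlgebra.eq_one_of_isTrivial (φ i₀) (hφ i₀) hi₀
    rw [Representation.character, hi₀.out g, LinearMap.trace_id, Module.finrank_fin_fun, hd1]
    simp
  rw [htriv] at hsum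
  exact hp.one_add_mul_ne_zero (IsIntegral.sum _ hz) hsum

/-! ### Both parts and non-simplicity. -/

theorem mainTheorem2 {G : Type*} [Group G] [Finite G] :
    (∀ (V : Type*) [AddCommGroup V] [Module ℂ V] [FiniteDimensional ℂ V]
        (ρ : Representation ℂ G V) (_ : ρ.IsIrreducible) (g : G),
        Nat.Coprime (conjugatesOf g).ncard (Module.finrank ℂ V) →
          ρ.asGroupHom.rangeRestrict g ∈ Subgroup.center ρ.asGroupHom.range ∨
            ρ.character g = 0) ∧
    (∀ (g : G) (p r : ℕ), p.Prime → 1 ≤ r → (conjugatesOf g).ncard = p ^ r →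
        (∃ (V : Type) (_ : AddCommGroup V) (_ : Module ℂ V) (_ : FiniteDimensional ℂ V)
          (ρ : Representation ℂ G V), ρ.IsIrreducible ∧ ¬ ρ.IsTrivial ∧
            ρ.asGroupHom.rangeRestrict '' conjugatesOf g ⊆
              (Subgroup.center ρ.asGroupHom.range : Set ρ.asGroupHom.range)) ∧
        ¬ IsSimpleGroup G) := by
  refine ⟨fun V _ _ _ ρ hρ g hg => ?_, fun g p r hp hr hC => ?_⟩
  · exact (Representation.IsIrreducible.eq_algebraMap_or_character_eq_zero ρ g hg).imp_left
      fun ⟨_, hc⟩ => ρ.rangeRestrict_mem_center_of_eq_algebraMap hc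
  have hnotcentral : ¬ ∀ h, h * g = g * h := by
    intro h
    have h1 : conjugatesOf g = {g} := by
      ext x
      simp only [conjugatesOf, Set.mem_ofPred_eq, isConj_iff, Set.mem_singleton_iff]
      refine ⟨?_, fun hx => ⟨1, by simp [hx]⟩⟩
      rintro ⟨c, rfl⟩
      rw [h c, mul_inv_cancel_right]
    rw [h1, Set.ncard_singleton] at hC
    exact (Nat.one_lt_pow (by omega) hp.one_lt).ne hC
  have hg1 : g ≠ 1 := by
    rintro rfl
    exact hnotcentral (by simp)
  obtain ⟨d, ρ, hirr, htriv, hpd, hχ⟩ :=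
    Representation.exists_isIrreducible_character_ne_zero hg1 hp
  have hcenter : ∀ x ∈ conjugatesOf g,
      ρ.asGroupHom.rangeRestrict x ∈ Subgroup.center ρ.asGroupHom.range := by
    intro x hx
    have hcop : Nat.Coprime (conjugatesOf x).ncard (Module.finrank ℂ (Fin d → ℂ)) := by
      rw [← IsConj.conjugatesOf_eq hx, hC, Module.finrank_fin_fun]
      exact Nat.Coprime.pow_left r ((Nat.Prime.coprime_iff_not_dvd hp).2 hpd)
    rcases Representation.IsIrreducible.eq_algebraMap_or_character_eq_zero ρ x hcop with
      ⟨c, hc⟩ | h0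
    · exact ρ.rangeRestrict_mem_center_of_eq_algebraMap hc
    · obtain ⟨h, rfl⟩ := isConj_iff.1 hx
      exact (hχ (by rwa [Representation.char_conj] at h0)).elim
  refine ⟨⟨Fin d → ℂ, inferInstance, inferInstance, inferInstance, ρ, hirr, htriv, ?_⟩, ?_⟩
  · rintro _ ⟨x, hx, rfl⟩
    exact hcenter x hx
  intro hsimple
  -- A trivial kernel would make g central, against |C| > 1; a full kernel would make ρ trivial.
  rcases hsimple.eq_bot_or_eq_top_of_normal ρ.asGroupHom.ker inferInstance with hker | hker
  · have hinj := (MonoidHom.ker_eq_bot_iff _).1 hker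
    refine hnotcentral fun h => hinj ?_
    have := Subgroup.mem_center_iff.1 (hcenter g mem_conjugatesOf_self)
      (ρ.asGroupHom.rangeRestrict h)
    simpa using congrArg Subtype.val this
  · refine htriv ⟨fun h => ?_⟩
    have : ρ.asGroupHom h = 1 := by
      rw [← MonoidHom.mem_ker, hker]
      exact Subgroup.mem_top h
    rw [← Representation.asGroupHom_apply, this]
    rfl
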